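/- A paratopological group is a group $G$ with a Hausdorff topology $\tau$ for which the multiplication $G\times G\to G$ is continuous. Its group reflexion is $G^\flat=(G,\tau^\flat)$, where $\tau^\flat$ is the strongest topology weaker than $\tau$ (not necessarily strictly) that makes $G$ a (not necessarily Hausdorff) topological group. $G$ is called $\flat$-regular if each $\tau$-neighborhood of the unit $e$ contains a $\tau$-neighborhood of $e$ that is closed in $\tau^\flat$, and totally bounded if for each neighborhood $U$ of $e$ there is a finite set $F\subset G$ with $G=FU=UF$. For a topological space $X$, the character $\chi(X)$ is the smallest cardinal $\lambda$ such that each point of $X$ has a neighborhood base of size $\le\lambda$, and the $\pi$-weight $\pi w(X)$ is the smallest size of a family of nonempty open subsets of $X$ such that each nonempty open subset of $X$ contains a member of the family. Let $\mathfrak d$ be the smallest size of a set $C\subset\mathbb N^{\omega}$ such that for each $x\in\mathbb N^\omega$ there is $y\in C$ with $x_i\le y_i$ for all $i$. For every uncountable cardinal $\kappa\le\mathfrak d$ there is a $\flat$-regular, totally bounded, countable abelian paratopological group $G$ with $\aleph_0=\chi(G^\flat)=\pi w(G)<\chi(G)=\kappa$. -/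

import Mathlib

open Cardinal Topology
open scoped Pointwise

universe u

/-- The dominating number `𝔡`: the smallest size of a set `C` of sequences of natural numbers
that is cofinal for the everywhere pointwise order. -/
noncomputable def dominatingNumber : Cardinal.{0} :=
  sInf {c | ∃ C : Set (ℕ → ℕ), (∀ x : ℕ → ℕ, ∃ y ∈ C, ∀ i, x i ≤ y i) ∧ #C = c}

/-- The character `χ(X)`: the smallest cardinal `c` such that each point of `X` has a neighborhood
base of size at most `c`. -/
noncomputable def character {X : Type u} (τ : TopologicalSpace X) : Cardinal.{u} :=
  sInf {c | ∀ x : X, ∃ B : Set (Set X),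
    (∀ V ∈ B, V ∈ 𝓝 x) ∧ (∀ U ∈ 𝓝 x, ∃ V ∈ B, V ⊆ U) ∧ #B ≤ c}

/-- A `π`-base: a family of nonempty open sets such that each nonempty open set contains a member
of the family. -/
def IsPiBase {X : Type u} (τ : TopologicalSpace X) (B : Set (Set X)) : Prop :=
  (∀ V ∈ B, IsOpen V ∧ V.Nonempty) ∧ ∀ U : Set X, IsOpen U → U.Nonempty → ∃ V ∈ B, V ⊆ U

/-- The `π`-weight `πw(X)`: the smallest size of a `π`-base. -/
noncomputable def piWeight {X : Type u} (τ : TopologicalSpace X) : Cardinal.{u} :=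
  sInf {c | ∃ B : Set (Set X), IsPiBase τ B ∧ #B = c}

/-- The topology `τ^♭` of the group reflexion: the strongest group topology weaker than `τ`.
In Mathlib's order on topologies `τ ≤ t` means that `t` is weaker than `τ`, so the
strongest group topology is the least one. -/
def flatGroupTopology {G : Type u} [Group G] (τ : TopologicalSpace G) : GroupTopology G :=
  sInf {t : GroupTopology G | τ ≤ t.toTopologicalSpace}

/-- The infimum above is attained. -/
theorem flatGroupTopology_isLeast {G : Type u} [Group G] (τ : TopologicalSpace G) :
    IsLeast {t : GroupTopology G | τ ≤ t.toTopologicalSpace} (flatGroupTopology τ) := by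
  refine ⟨?_, fun t ht => sInf_le ht⟩
  change τ ≤ (sInf {t : GroupTopology G | τ ≤ t.toTopologicalSpace}).toTopologicalSpace
  rw [GroupTopology.toTopologicalSpace_sInf]
  refine le_sInf ?_
  rintro _ ⟨t, ht, rfl⟩
  exact ht

/-- The topology `τ^♭` as a bare topology on `G`. -/
abbrev flatTopology {G : Type u} [Group G] (τ : TopologicalSpace G) : TopologicalSpace G :=
  (flatGroupTopology τ).toTopologicalSpace

/-- `♭`-regularity: each neighborhood of the unit contains a neighborhood of the unit that is closed
in `τ^♭`. -/
def IsFlatRegular {G : Type u} [Group G] (τ : TopologicalSpace G) : Prop :=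
  ∀ U ∈ 𝓝 (1 : G), ∃ F ∈ 𝓝 (1 : G), F ⊆ U ∧ IsClosed[flatTopology τ] F

/-- Total boundedness of a paratopological group: for each neighborhood `U` of the unit there is a
finite set `F` with `G = FU = UF`. -/
def IsTotallyBoundedGroup {G : Type u} [Group G] (τ : TopologicalSpace G) : Prop :=
  ∀ U ∈ 𝓝 (1 : G), ∃ F : Set G, F.Finite ∧ F * U = Set.univ ∧ U * F = Set.univ

/-! Embed `ℤ × ℤ` densely in the circle times the 2-adic integers by `(a, b) ↦ (a √2, b)`; this
gives a countable, precompact, metrizable group. Refine its topology by one-sided cones: the circle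
coordinate `t` is small and nonnegative, and `t < 2⁻ⁿ` forces `2 ^ f n ∣ b`. A cone has interior
points in the coarse topology, so the coarse topology is the group reflexion, the π-weight is
countable and total boundedness is inherited; cones are closed there, which is `♭`-regularity. The
character is governed by the slopes `f`. Take `κ` distinct binary branches, possible as `κ ≤ 𝔡 ≤ 𝔠`;
their sets of prefix codes are almost disjoint. Let `f` be `n` plus the indicator of a finite union
of these sets. A cone for `s` inside the cone for `{i}` forces `i ∈ s` (`le_of_cone_subset`,
`mem_of_steepness_le`), so a local base cannot have fewer than `κ` members. -/

open Filter in
/-- A directed family of sets containing `1` and shrinkable under multiplication is a neighborhood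
base at `1` for a topology with continuous multiplication. -/
theorem exists_topology_hasBasis {G ι : Type*} [CommGroup G] [Nonempty ι] (W : ι → Set G)
    (hdir : ∀ i j, ∃ k, W k ⊆ W i ∧ W k ⊆ W j) (hone : ∀ i, 1 ∈ W i)
    (hmul : ∀ i, ∃ j, W j * W j ⊆ W i) :
    ∃ _ : TopologicalSpace G, ContinuousMul G ∧
      ∀ x : G, (𝓝 x).HasBasis (fun _ : ι => True) (fun i => (x * ·) '' W i) := by
  have hN : (⨅ i, 𝓟 (W i)).HasBasis (fun _ : ι => True) W :=
    hasBasis_iInf_principal fun i j => hdir i j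
  set N : Filter G := ⨅ i, 𝓟 (W i) with hNdef
  have hb : ∀ x : G, (map (x * ·) N).HasBasis (fun _ : ι => True) (fun i => (x * ·) '' W i) :=
    fun x => hN.map _
  let τ : TopologicalSpace G := .mkOfNhds fun x => map (x * ·) N
  have hnhds : ∀ x : G, 𝓝 x = map (x * ·) N := by
    intro x
    refine TopologicalSpace.nhds_mkOfNhds_of_hasBasis hb (fun a i _ => ⟨1, hone i, mul_one a⟩)
      (fun a i _ => ?_) x
    obtain ⟨j, hj⟩ := hmul i
    refine (hb a).eventually_iff.2 ⟨j, trivial, ?_⟩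
    rintro _ ⟨y, hy, rfl⟩
    refine (hb _).mem_iff.2 ⟨j, trivial, ?_⟩
    rintro _ ⟨z, hz, rfl⟩
    exact ⟨y * z, hj (Set.mul_mem_mul hy hz), (mul_assoc a y z).symm⟩
  have h1 : 𝓝 (1 : G) = N := by simpa using hnhds 1
  refine ⟨τ, ?_, fun x => by rw [hnhds x]; exact hb x⟩
  refine ContinuousMul.of_nhds_one ?_ (fun x => by rw [hnhds x, h1])
    (fun x => by simp_rw [mul_comm _ x]; rw [hnhds x, h1])
  rw [h1]
  refine ((hN.prod hN).tendsto_iff hN).2 fun i _ => ?_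
  obtain ⟨j, hj⟩ := hmul i
  exact ⟨(j, j), ⟨trivial, trivial⟩, fun p hp => hj (Set.mul_mem_mul hp.1 hp.2)⟩

/-! ### Abstract cone systems and their cardinal invariants -/

/-- A sequence `V` of symmetric sets forming a neighborhood base at `1` of a precompact Hausdorff
group topology, together with a family `U` of `V`-closed sets with `V`-interior points, which forms
a neighborhood base at `1` of a paratopological group topology. -/
structure ConeSystem (G K : Type*) [CommGroup G] where
  V : ℕ → Set G
  U : Finset K → ℕ → Set G
  V_anti : Antitone V
  V_mul : ∀ n, V (n + 1) * V (n + 1) ⊆ V n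
  V_inv : ∀ n, ∀ x ∈ V n, x⁻¹ ∈ V n
  V_sep : ∀ x, x ≠ 1 → ∃ n, x ∉ V n
  V_cover : ∀ n, ∃ F : Set G, F.Finite ∧ F * V n = Set.univ
  one_mem_U : ∀ s k, 1 ∈ U s k
  U_subset_V : ∀ s k, U s k ⊆ V k
  U_mul : ∀ s k, U s (k + 1) * U s (k + 1) ⊆ U s k
  U_anti : ∀ ⦃s t : Finset K⦄ ⦃k l : ℕ⦄, s ⊆ t → k ≤ l → U t l ⊆ U s k
  U_interior : ∀ s k, ∃ w m, (w * ·) '' V m ⊆ U s k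
  U_closed : ∀ s k x, x ∉ U s k → ∃ m, Disjoint ((x * ·) '' V m) (U s k)
  U_indep : ∀ s k i, U s k ⊆ U {i} 0 → i ∈ s

namespace ConeSystem

variable {G K : Type} [CommGroup G] (S : ConeSystem G K)

theorem one_mem_V (n : ℕ) : 1 ∈ S.V n := S.U_subset_V ∅ n (S.one_mem_U ∅ n)

theorem exists_groupTopology :
    ∃ t : GroupTopology G, (@nhds G t.toTopologicalSpace 1).HasBasis (fun _ : ℕ => True) S.V := by
  obtain ⟨t, ht, hb⟩ := exists_topology_hasBasis S.V
    (fun i j => ⟨max i j, S.V_anti (le_max_left i j), S.V_anti (le_max_right i j)⟩)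
    S.one_mem_V (fun n => ⟨n + 1, S.V_mul n⟩)
  have h1 : (𝓝 (1 : G)).HasBasis (fun _ : ℕ => True) S.V := by simpa using hb 1
  have hinv : ContinuousInv G := by
    refine ⟨continuous_iff_continuousAt.2 fun x => ?_⟩
    refine ((hb x).tendsto_iff (hb x⁻¹)).2 fun n _ => ⟨n, trivial, ?_⟩
    rintro _ ⟨v, hv, rfl⟩
    exact ⟨v⁻¹, S.V_inv n v hv, by simp [mul_comm]⟩
  exact ⟨{ t with toContinuousMul := ht, toContinuousInv := hinv }, h1⟩

theorem exists_paratopology [DecidableEq K] :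
    ∃ _ : TopologicalSpace G, ContinuousMul G ∧ ∀ x : G, (𝓝 x).HasBasis
      (fun _ : Finset K × ℕ => True) (fun i => (x * ·) '' S.U i.1 i.2) :=
  exists_topology_hasBasis (fun i : Finset K × ℕ => S.U i.1 i.2)
    (fun i j => ⟨(i.1 ∪ j.1, max i.2 j.2),
      S.U_anti Finset.subset_union_left (le_max_left _ _),
      S.U_anti Finset.subset_union_right (le_max_right _ _)⟩)
    (fun i => S.one_mem_U i.1 i.2) (fun i => ⟨(i.1, i.2 + 1), S.U_mul i.1 i.2⟩)

/-- The translates of the sets `U s k` are neighborhood bases for the topology `τ`. -/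
def Generates (τ : TopologicalSpace G) : Prop :=
  ∀ x : G, (𝓝 x).HasBasis (fun _ : Finset K × ℕ => True) (fun i => (x * ·) '' S.U i.1 i.2)

variable {S} {τ : TopologicalSpace G}

theorem Generates.nhds_one (hτ : S.Generates τ) :
    (𝓝 (1 : G)).HasBasis (fun _ : Finset K × ℕ => True) (fun i => S.U i.1 i.2) := by
  simpa using hτ 1

/-- In a group topology weaker than `τ`, a neighborhood of `1` contains some `U U⁻¹`. If `w V ⊆ U`,
then `V ⊆ U U⁻¹`, so that topology is also weaker than the one given by `V`. -/
theorem Generates.nhds_one_flat (hτ : S.Generates τ) :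
    (@nhds G (flatTopology τ) 1).HasBasis (fun _ : ℕ => True) S.V := by
  obtain ⟨t, ht⟩ := S.exists_groupTopology
  have hle : τ ≤ t.toTopologicalSpace := by
    refine le_of_nhds_le_nhds fun x => ?_
    have htg := t.toIsTopologicalGroup
    have hx : (@nhds G t.toTopologicalSpace x).HasBasis (fun _ : ℕ => True)
        (fun n => (x * ·) '' S.V n) := by
      rw [← @map_mul_left_nhds_one G t.toTopologicalSpace]
      exact ht.map _
    exact ((hτ x).le_basis_iff hx).2 fun n _ =>
      ⟨(∅, n), trivial, Set.image_mono (S.U_subset_V ∅ n)⟩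
  have hflat := (flatGroupTopology_isLeast τ).2 hle
  refine ⟨fun N => ⟨fun hN => ?_, fun ⟨n, _, hn⟩ => Filter.mem_of_superset
    (nhds_mono hflat (ht.mem_of_mem trivial)) hn⟩⟩
  have hfg := (flatGroupTopology τ).toIsTopologicalGroup
  obtain ⟨M, hM, hMN⟩ := (@exists_nhds_split_inv G (flatTopology τ) _ _ N hN)
  have hMτ : M ∈ @nhds G τ 1 := nhds_mono (flatGroupTopology_isLeast τ).1 hM
  obtain ⟨⟨s, k⟩, -, hU⟩ := hτ.nhds_one.mem_iff.1 hMτ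
  obtain ⟨w, m, hw⟩ := S.U_interior s k
  refine ⟨m, trivial, fun v hv => ?_⟩
  have := hMN (w * v) (hU (hw ⟨v, hv, rfl⟩)) (w * 1) (hU (hw ⟨1, S.one_mem_V m, rfl⟩))
  simpa using this

theorem Generates.nhds_flat (hτ : S.Generates τ) (x : G) :
    (@nhds G (flatTopology τ) x).HasBasis (fun _ : ℕ => True) (fun n => (x * ·) '' S.V n) := by
  have hfg := (flatGroupTopology τ).toIsTopologicalGroup
  rw [← @map_mul_left_nhds_one G (flatTopology τ)]
  exact hτ.nhds_one_flat.map _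

theorem Generates.t2Space_flat (hτ : S.Generates τ) : @T2Space G (flatTopology τ) := by
  have hfg := (flatGroupTopology τ).toIsTopologicalGroup
  refine @IsTopologicalGroup.t2Space_of_one_sep G (flatTopology τ) _ _ fun x hx => ?_
  obtain ⟨n, hn⟩ := S.V_sep x hx
  exact ⟨S.V n, hτ.nhds_one_flat.mem_of_mem trivial, hn⟩

theorem Generates.t2Space (hτ : S.Generates τ) : T2Space G :=
  t2Space_antitone (flatGroupTopology_isLeast τ).1 hτ.t2Space_flat

theorem Generates.isFlatRegular (hτ : S.Generates τ) : IsFlatRegular τ := by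
  intro N hN
  obtain ⟨⟨s, k⟩, -, hU⟩ := hτ.nhds_one.mem_iff.1 hN
  refine ⟨S.U s k, hτ.nhds_one.mem_of_mem (i := (s, k)) trivial, hU, ?_⟩
  rw [← @isOpen_compl_iff G _ (flatTopology τ), @isOpen_iff_mem_nhds G (flatTopology τ)]
  intro x hx
  obtain ⟨m, hm⟩ := S.U_closed s k x hx
  exact (hτ.nhds_flat x).mem_iff.2 ⟨m, trivial, hm.subset_compl_right⟩

theorem Generates.isTotallyBoundedGroup (hτ : S.Generates τ) : IsTotallyBoundedGroup τ := by
  intro N hN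
  obtain ⟨⟨s, k⟩, -, hU⟩ := hτ.nhds_one.mem_iff.1 hN
  obtain ⟨w, m, hw⟩ := S.U_interior s k
  obtain ⟨F, hF, hcov⟩ := S.V_cover m
  have h : (· * w⁻¹) '' F * N = Set.univ := by
    refine Set.eq_univ_of_forall fun x => ?_
    obtain ⟨f, hf, v, hv, rfl⟩ := Set.mem_mul.1 (hcov.symm ▸ Set.mem_univ x)
    exact Set.mem_mul.2 ⟨f * w⁻¹, ⟨f, hf, rfl⟩, w * v, hU (hw ⟨v, hv, rfl⟩), by group⟩
  exact ⟨_, hF.image _, h, by rw [mul_comm, h]⟩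

theorem infinite_V [Infinite G] (n : ℕ) : (S.V n).Infinite := by
  intro hfin
  obtain ⟨F, hF, hcov⟩ := S.V_cover n
  exact Set.infinite_univ (hcov ▸ hF.mul hfin)

theorem Generates.character_flat [Infinite G] (hτ : S.Generates τ) :
    character (flatTopology τ) = ℵ₀ := by
  have hmem : ∀ x : G, ∃ B : Set (Set G), (∀ V ∈ B, V ∈ @nhds G (flatTopology τ) x) ∧
      (∀ U ∈ @nhds G (flatTopology τ) x, ∃ V ∈ B, V ⊆ U) ∧ #B ≤ ℵ₀ := by
    refine fun x => ⟨Set.range fun n => (x * ·) '' S.V n, ?_, ?_, ?_⟩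
    · rintro _ ⟨n, rfl⟩
      exact (hτ.nhds_flat x).mem_of_mem trivial
    · intro U hU
      obtain ⟨n, -, hn⟩ := (hτ.nhds_flat x).mem_iff.1 hU
      exact ⟨_, ⟨n, rfl⟩, hn⟩
    · exact le_aleph0_iff_set_countable.2 (Set.countable_range _)
  refine le_antisymm (csInf_le' hmem) (le_csInf ⟨_, hmem⟩ fun c hc => ?_)
  obtain ⟨B, hB, hB', hBc⟩ := hc 1
  by_contra! hlt
  have hfin : B.Finite := lt_aleph0_iff_set_finite.1 (hBc.trans_lt hlt)
  have hinter : ⋂₀ B ∈ @nhds G (flatTopology τ) 1 := (Filter.sInter_mem hfin).2 hB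
  obtain ⟨n, -, hn⟩ := hτ.nhds_one_flat.mem_iff.1 hinter
  -- A finite base would have an intersection contained in every `V m`, hence in `{1}`, while `V n`
  -- is infinite by precompactness.
  refine (infinite_V (S := S) n) ((Set.finite_singleton (1 : G)).subset fun v hv => ?_)
  by_contra hv1
  obtain ⟨m, hm⟩ := S.V_sep v hv1
  obtain ⟨W, hW, hWm⟩ := hB' (S.V m) (hτ.nhds_one_flat.mem_of_mem trivial)
  exact hm (hWm (hn hv W hW))

theorem Generates.piWeight_eq [Infinite G] [Countable G] (hτ : S.Generates τ) :
    piWeight τ = ℵ₀ := by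
  let f : G × ℕ → Set G := fun p => @interior G (flatTopology τ) ((p.1 * ·) '' S.V p.2)
  have hf : IsPiBase τ (Set.range f) := by
    refine ⟨?_, fun O hO ⟨x, hx⟩ => ?_⟩
    · rintro _ ⟨⟨x, n⟩, rfl⟩
      refine ⟨(flatGroupTopology_isLeast τ).1 _ (@isOpen_interior G (flatTopology τ) _), x, ?_⟩
      exact (@mem_interior_iff_mem_nhds G (flatTopology τ) _ _).2
        ((hτ.nhds_flat x).mem_of_mem trivial)
    · obtain ⟨⟨s, k⟩, -, hU⟩ := (hτ x).mem_iff.1 (hO.mem_nhds hx)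
      obtain ⟨w, m, hw⟩ := S.U_interior s k
      refine ⟨_, ⟨(x * w, m), rfl⟩,
        (@interior_subset G (flatTopology τ) _).trans (subset_trans ?_ hU)⟩
      rintro _ ⟨v, hv, rfl⟩
      exact ⟨w * v, hw ⟨v, hv, rfl⟩, (mul_assoc x w v).symm⟩
  have hmem : #(Set.range f) ∈ {c | ∃ B : Set (Set G), IsPiBase τ B ∧ #B = c} := ⟨_, hf, rfl⟩
  refine le_antisymm ((csInf_le' hmem).trans
    (le_aleph0_iff_set_countable.2 (Set.countable_range _))) (le_csInf ⟨_, hmem⟩ ?_)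
  rintro _ ⟨B, hB, rfl⟩
  by_contra! hlt
  have := (lt_aleph0_iff_set_finite.1 hlt).to_subtype
  have := hτ.t2Space
  choose p hp using fun V : B => (hB.1 V V.2).2
  have hfin : (Set.range p).Finite := Set.finite_range p
  -- One point from each member of a finite π-base gives a closed finite set whose open complement
  -- contains no member.
  obtain ⟨V, hV, hVs⟩ := hB.2 _ hfin.isClosed.isOpen_compl hfin.infinite_compl.nonempty
  exact hVs (hp ⟨V, hV⟩) ⟨_, rfl⟩

theorem Generates.character_eq (hK : ℵ₀ < #K) (hτ : S.Generates τ) :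
    character τ = #K := by
  have : Infinite K := infinite_iff.2 hK.le
  have hmem : ∀ x : G, ∃ B : Set (Set G), (∀ V ∈ B, V ∈ 𝓝 x) ∧
      (∀ U ∈ 𝓝 x, ∃ V ∈ B, V ⊆ U) ∧ #B ≤ #K := by
    refine fun x => ⟨Set.range fun i : Finset K × ℕ => (x * ·) '' S.U i.1 i.2, ?_, ?_, ?_⟩
    · rintro _ ⟨i, rfl⟩
      exact (hτ x).mem_of_mem trivial
    · intro U hU
      obtain ⟨i, -, hi⟩ := (hτ x).mem_iff.1 hU
      exact ⟨_, ⟨i, rfl⟩, hi⟩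
    · refine mk_range_le.trans ?_
      rw [mk_prod, lift_id, lift_id, mk_finset_of_infinite, mk_nat, mul_aleph0_eq hK.le]
  refine le_antisymm (csInf_le' hmem) (le_csInf ⟨_, hmem⟩ fun c hc => ?_)
  obtain ⟨B, hB, hB', hBc⟩ := hc 1
  refine le_trans ?_ hBc
  choose i _ hi using fun V : B => hτ.nhds_one.mem_iff.1 (hB V V.2)
  -- Each base member contains some `U s k`; by `U_indep` the finite sets `s` so obtained cover `K`.
  have hcov : (⋃ V : B, ((i V).1 : Set K)) = Set.univ := by
    refine Set.eq_univ_of_forall fun a => ?_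
    obtain ⟨V, hV, hVa⟩ := hB' (S.U {a} 0) (hτ.nhds_one.mem_of_mem (i := ({a}, 0)) trivial)
    exact Set.mem_iUnion.2 ⟨⟨V, hV⟩, S.U_indep _ _ _ ((hi ⟨V, hV⟩).trans hVa)⟩
  have hle : #K ≤ #B * ℵ₀ := by
    calc #K = #(⋃ V : B, ((i V).1 : Set K)) := by rw [hcov, mk_univ]
      _ ≤ _ := mk_iUnion_le _
      _ ≤ #B * ℵ₀ := mul_le_mul' le_rfl (ciSup_le' fun V => (finset_card_lt_aleph0 _).le)
  rcases le_or_gt ℵ₀ #B with h | h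
  · rwa [mul_aleph0_eq h] at hle
  · exact absurd (hle.trans (mul_le_mul' h.le le_rfl)) (by simpa using hK)

end ConeSystem

/-! ### An almost disjoint family from binary branches -/

/-- The codes of the initial segments of a binary sequence. -/
def prefixCodes (x : ℕ → Bool) : Set ℕ :=
  Set.range fun k => Encodable.encode ((List.range k).map x)

theorem encode_prefix_injective (x : ℕ → Bool) :
    Function.Injective fun k => Encodable.encode ((List.range k).map x) := by
  intro k l h
  simpa using congrArg List.length (Encodable.encode_injective h)

theorem prefixCodes_infinite (x : ℕ → Bool) : (prefixCodes x).Infinite :=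
  Set.infinite_range_of_injective (encode_prefix_injective x)

theorem prefixCodes_inter_finite {x y : ℕ → Bool} (hxy : x ≠ y) :
    (prefixCodes x ∩ prefixCodes y).Finite := by
  obtain ⟨j, hj⟩ := Function.ne_iff.1 hxy
  refine ((Set.finite_Iic j).image
    fun k => Encodable.encode ((List.range k).map x)).subset ?_
  rintro _ ⟨⟨k, rfl⟩, ⟨l, hl⟩⟩
  refine ⟨k, ?_, rfl⟩
  have hl' := Encodable.encode_injective hl
  have hlen : l = k := by simpa using congrArg List.length hl'
  subst hlen
  by_contra hk
  have hk' : j < l := by simpa using hk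
  exact hj ((List.map_inj_left.1 hl' j (List.mem_range.2 hk')).symm)

/-! ### Cones in the dense subgroup of circle times 2-adic integers -/

/-- A base at `0` of the topology of `ℤ × ℤ` induced by the embedding `(a, b) ↦ (a √2, b)` into the
product of the circle `ℝ / ℤ` and the `2`-adic integers. -/
def denseBall (n : ℕ) : Set (ℤ × ℤ) :=
  {g | ∃ p : ℤ, |(g.1 : ℝ) * Real.sqrt 2 - p| < (1 / 2) ^ n ∧ (2 : ℤ) ^ n ∣ g.2}

/-- A cone in `ℤ × ℤ`: the first coordinate lies to the right of `0` in the circle, and the second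
one is the more divisible by `2`, as prescribed by `f`, the closer the first one is to `0`. -/
def cone (f : ℕ → ℕ) (k : ℕ) : Set (ℤ × ℤ) :=
  {g | ∃ p : ℤ, 0 ≤ (g.1 : ℝ) * Real.sqrt 2 - p ∧ (g.1 : ℝ) * Real.sqrt 2 - p ≤ (1 / 2) ^ (k + 2) ∧
    ∀ n, (g.1 : ℝ) * Real.sqrt 2 - p < (1 / 2) ^ n → (2 : ℤ) ^ f n ∣ g.2}

theorem half_pow_le {m n : ℕ} (h : m ≤ n) : (1 / 2 : ℝ) ^ n ≤ (1 / 2) ^ m :=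
  pow_le_pow_of_le_one (by norm_num) (by norm_num) h

theorem int_eq_of_abs_sub_lt {p q : ℤ} (h : |(p : ℝ) - q| < 1) : p = q := by
  have h' : |p - q| < 1 := by exact_mod_cast h
  have := Int.abs_lt_one_iff.1 h'
  omega

theorem eq_zero_of_forall_pow_dvd {b : ℤ} (h : ∀ n : ℕ, (2 : ℤ) ^ n ∣ b) : b = 0 := by
  by_contra hb
  have h1 := Int.natAbs_dvd_natAbs.2 (h b.natAbs)
  rw [Int.natAbs_pow] at h1
  exact absurd (Nat.le_of_dvd (Int.natAbs_pos.2 hb) h1) (not_le.2 Nat.lt_two_pow_self)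

theorem eq_zero_of_mul_sqrt_two_eq {a p : ℤ} (h : (a : ℝ) * Real.sqrt 2 = p) : a = 0 := by
  by_contra ha
  exact (irrational_sqrt_two.intCast_mul ha).ne_int p h

theorem exists_mul_sqrt_two_sub_mem_Ioo {s t : ℝ} (hst : s < t) :
    ∃ a p : ℤ, s < (a : ℝ) * Real.sqrt 2 - p ∧ (a : ℝ) * Real.sqrt 2 - p < t := by
  have hd : Dense (AddSubgroup.closure {Real.sqrt 2, 1} : Set ℝ) :=
    dense_addSubgroupClosure_pair_iff.2 (by simpa using irrational_sqrt_two)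
  obtain ⟨x, hx, hxs⟩ := hd.exists_between hst
  obtain ⟨a, p, rfl⟩ := AddSubgroup.mem_closure_pair.1 hx
  refine ⟨a, -p, ?_, ?_⟩
  · simpa using hxs.1
  · simpa using hxs.2

theorem denseBall_anti : Antitone denseBall := fun _ _ h _ ⟨p, hp, hb⟩ =>
  ⟨p, hp.trans_le (half_pow_le h), (pow_dvd_pow 2 h).trans hb⟩

theorem denseBall_add {n : ℕ} {x y : ℤ × ℤ} (hx : x ∈ denseBall (n + 1))
    (hy : y ∈ denseBall (n + 1)) : x + y ∈ denseBall n := by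
  obtain ⟨p, hp, hpb⟩ := hx
  obtain ⟨q, hq, hqb⟩ := hy
  refine ⟨p + q, ?_, (pow_dvd_pow 2 n.le_succ).trans (dvd_add hpb hqb)⟩
  rw [pow_succ, abs_lt] at hp hq
  rw [abs_lt]
  push_cast [Prod.fst_add]
  constructor <;> linarith [hp.1, hp.2, hq.1, hq.2]

theorem denseBall_neg {n : ℕ} {x : ℤ × ℤ} (hx : x ∈ denseBall n) : -x ∈ denseBall n := by
  obtain ⟨p, hp, hpb⟩ := hx
  refine ⟨-p, ?_, (dvd_neg (b := x.2)).2 hpb⟩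
  rw [← abs_neg] at hp
  convert hp using 2
  push_cast [Prod.fst_neg]
  ring

theorem exists_notMem_denseBall {x : ℤ × ℤ} (hx : x ≠ 0) : ∃ n, x ∉ denseBall n := by
  by_contra! h
  have hb : x.2 = 0 := eq_zero_of_forall_pow_dvd fun n => (h n).choose_spec.2
  choose p hp _ using h
  have hpe : ∀ n, p (n + 1) = p 1 := by
    intro n
    refine int_eq_of_abs_sub_lt ?_
    have h1 := (hp (n + 1)).trans_le (half_pow_le (Nat.le_add_left 1 n))
    have h2 := hp 1
    rw [abs_lt] at *
    constructor <;> linarith [h1.1, h1.2, h2.1, h2.2]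
  have hz : (x.1 : ℝ) * Real.sqrt 2 - p 1 = 0 := by
    by_contra hne
    obtain ⟨n, hn⟩ := exists_pow_lt_of_lt_one (abs_pos.2 hne) (by norm_num : (1 / 2 : ℝ) < 1)
    have := (hp (n + 1)).trans_le (half_pow_le n.le_succ)
    rw [hpe n] at this
    exact lt_asymm hn this
  exact hx (Prod.ext (eq_zero_of_mul_sqrt_two_eq (sub_eq_zero.1 hz)) hb)

theorem exists_finite_add_denseBall (n : ℕ) :
    ∃ F : Set (ℤ × ℤ), F.Finite ∧ ∀ x, ∃ f ∈ F, x - f ∈ denseBall n := by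
  -- Cells: an arc of length `2⁻ⁿ` and a residue mod `2 ^ n`. One representative per nonempty cell
  -- suffices.
  let c : ℤ × ℤ → ℤ × ℤ := fun x =>
    (⌊(2 : ℝ) ^ n * Int.fract ((x.1 : ℝ) * Real.sqrt 2)⌋, x.2 % 2 ^ n)
  have hfin : (Set.range c).Finite := by
    refine ((Set.finite_Icc (0 : ℤ) (2 ^ n)).prod (Set.finite_Icc (0 : ℤ) (2 ^ n))).subset ?_
    rintro _ ⟨x, rfl⟩
    refine ⟨⟨Int.floor_nonneg.2 (mul_nonneg (by positivity) (Int.fract_nonneg _)), ?_⟩,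
      Int.emod_nonneg _ (by positivity), (Int.emod_lt_of_pos _ (by positivity)).le⟩
    have h1 : (2 : ℝ) ^ n * Int.fract ((x.1 : ℝ) * Real.sqrt 2) ≤ 2 ^ n :=
      mul_le_of_le_one_right (by positivity) (Int.fract_lt_one _).le
    exact Int.le_of_lt_add_one (Int.floor_lt.2 (by push_cast; linarith))
  have := hfin.to_subtype
  refine ⟨Set.range fun t : Set.range c => t.2.choose, Set.finite_range _, fun x => ?_⟩
  set y := (⟨x, rfl⟩ : c x ∈ Set.range c).choose with hy
  have hyx : c y = c x := (⟨x, rfl⟩ : c x ∈ Set.range c).choose_spec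
  refine ⟨y, ⟨⟨c x, x, rfl⟩, rfl⟩, ⌊(x.1 : ℝ) * Real.sqrt 2⌋ - ⌊(y.1 : ℝ) * Real.sqrt 2⌋, ?_, ?_⟩
  · have h1 := Int.abs_sub_lt_one_of_floor_eq_floor (congrArg Prod.fst hyx).symm
    have he : ((x - y).1 : ℝ) * Real.sqrt 2 -
        (⌊(x.1 : ℝ) * Real.sqrt 2⌋ - ⌊(y.1 : ℝ) * Real.sqrt 2⌋ : ℤ) =
        Int.fract ((x.1 : ℝ) * Real.sqrt 2) - Int.fract ((y.1 : ℝ) * Real.sqrt 2) := by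
      push_cast [Prod.fst_sub, Int.fract]; ring
    rw [← mul_sub, abs_mul, abs_of_pos (by positivity : (0 : ℝ) < 2 ^ n), mul_comm] at h1
    rw [he, one_div_pow]
    exact (lt_div_iff₀ (by positivity)).2 h1
  · exact Int.ModEq.dvd (congrArg Prod.snd hyx)

variable {f g : ℕ → ℕ} {k l : ℕ}

theorem zero_mem_cone : 0 ∈ cone f k := ⟨0, by simp, by simp, by simp⟩

theorem cone_subset_denseBall (hf : ∀ n, n ≤ f n) : cone f k ⊆ denseBall k := by
  rintro x ⟨p, h0, h1, h⟩
  have hlt : (x.1 : ℝ) * Real.sqrt 2 - p < (1 / 2) ^ k :=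
    h1.trans_lt (pow_lt_pow_right_of_lt_one₀ (by norm_num) (by norm_num) (by omega))
  exact ⟨p, by rwa [abs_of_nonneg h0], (pow_dvd_pow 2 (hf k)).trans (h k hlt)⟩

/-- Both circle coordinates are nonnegative, so a bound on their sum bounds each and the
divisibility conditions pass to the sum, whatever `f` is. -/
theorem cone_add {x y : ℤ × ℤ} (hx : x ∈ cone f (k + 1)) (hy : y ∈ cone f (k + 1)) :
    x + y ∈ cone f k := by
  obtain ⟨p, hp0, hp1, hp⟩ := hx
  obtain ⟨q, hq0, hq1, hq⟩ := hy
  have he : ((x + y).1 : ℝ) * Real.sqrt 2 - (p + q : ℤ) =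
      ((x.1 : ℝ) * Real.sqrt 2 - p) + ((y.1 : ℝ) * Real.sqrt 2 - q) := by
    push_cast [Prod.fst_add]; ring
  refine ⟨p + q, ?_, ?_, fun n hn => ?_⟩
  · rw [he]; positivity
  · rw [he]
    rw [show k + 1 + 2 = k + 2 + 1 by ring, pow_succ] at hp1 hq1
    linarith
  · rw [he] at hn
    exact dvd_add (hp n (by linarith)) (hq n (by linarith))

theorem cone_anti (hfg : f ≤ g) (hkl : k ≤ l) : cone g l ⊆ cone f k :=
  fun _ ⟨p, h0, h1, h⟩ => ⟨p, h0, h1.trans (half_pow_le (by omega)),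
    fun n hn => (pow_dvd_pow 2 (hfg n)).trans (h n hn)⟩

theorem exists_add_denseBall_subset_cone (f : ℕ → ℕ) (k : ℕ) :
    ∃ w m, ∀ v ∈ denseBall m, w + v ∈ cone f k := by
  have hpos : (0 : ℝ) < (1 / 2) ^ (k + 3) := by positivity
  obtain ⟨a, p, h0, h1⟩ := exists_mul_sqrt_two_sub_mem_Ioo hpos
  set t := (a : ℝ) * Real.sqrt 2 - p with ht
  -- Perturbing `t` by less than `2⁻ᴺ < t / 2` keeps it above `2⁻ᴺ`, so only the finitely many
  -- conditions with `n < N` are active.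
  obtain ⟨N, hN⟩ := exists_pow_lt_of_lt_one (half_pos h0) (by norm_num : (1 / 2 : ℝ) < 1)
  refine ⟨(a, 0), max (max N (k + 3)) ((Finset.range N).sup f), fun v ⟨q, hq, hv⟩ => ?_⟩
  have hqN := hq.trans_le (half_pow_le ((le_max_left _ _).trans (le_max_left _ _)))
  have hqk := hq.trans_le (half_pow_le ((le_max_right _ _).trans (le_max_left _ _)))
  rw [abs_lt] at hqN hqk
  have he : (((a, 0) + v : ℤ × ℤ).1 : ℝ) * Real.sqrt 2 - (p + q : ℤ) =
      t + ((v.1 : ℝ) * Real.sqrt 2 - q) := by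
    rw [ht]; push_cast [Prod.fst_add]; ring
  refine ⟨p + q, ?_, ?_, fun n hn => ?_⟩
  · rw [he]; linarith [hqN.1]
  · rw [he]
    rw [pow_succ _ (k + 2)] at h1 hqk
    linarith [hqk.2]
  · rw [he] at hn
    have hnN : n < N := by
      by_contra! h
      linarith [half_pow_le h, hqN.1]
    have : f n ≤ (Finset.range N).sup f := Finset.le_sup (Finset.mem_range.2 hnN)
    simpa using (pow_dvd_pow 2 (this.trans (le_max_right _ _))).trans hv

theorem mem_cone_of_forall_exists {x : ℤ × ℤ}
    (h : ∀ m, ∃ v ∈ denseBall m, x + v ∈ cone f k) : x ∈ cone f k := by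
  have key : ∀ m, ∃ v : ℤ × ℤ, ∃ q : ℤ, ∃ e : ℝ, |e| < (1 / 2) ^ m ∧ (2 : ℤ) ^ m ∣ v.2 ∧
      0 ≤ (x.1 : ℝ) * Real.sqrt 2 - q + e ∧
      (x.1 : ℝ) * Real.sqrt 2 - q + e ≤ (1 / 2) ^ (k + 2) ∧
      ∀ n, (x.1 : ℝ) * Real.sqrt 2 - q + e < (1 / 2) ^ n → (2 : ℤ) ^ f n ∣ x.2 + v.2 := by
    intro m
    obtain ⟨v, ⟨p', hp', hv⟩, p, hp⟩ := h m
    refine ⟨v, p - p', (v.1 : ℝ) * Real.sqrt 2 - p', hp', hv, ?_⟩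
    have he : (x.1 : ℝ) * Real.sqrt 2 - (p - p' : ℤ) + ((v.1 : ℝ) * Real.sqrt 2 - p') =
        ((x + v).1 : ℝ) * Real.sqrt 2 - p := by
      push_cast [Prod.fst_add]; ring
    rw [he]
    exact hp
  choose v q e he hv h0 h1 hd using key
  have hk : (1 / 2 : ℝ) ^ (k + 2) ≤ 1 / 4 := (half_pow_le (Nat.le_add_left 2 k)).trans (by norm_num)
  -- The cone has width at most `1/4` and the errors are below `1/4`, so the integer part cannot
  -- change.
  have hq : ∀ m, 2 ≤ m → q m = q 2 := by
    intro m hm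
    refine int_eq_of_abs_sub_lt ?_
    have h2 := (he m).trans_le (half_pow_le hm)
    have h3 := he 2
    rw [abs_lt] at *
    norm_num at h2 h3
    constructor <;> linarith [h0 m, h1 m, h0 2, h1 2, h2.1, h2.2, h3.1, h3.2]
  have hlim : ∀ δ > 0, ∀ N, ∃ m, N ≤ m ∧ 2 ≤ m ∧ |e m| < δ := by
    intro δ hδ N
    obtain ⟨j, hj⟩ := exists_pow_lt_of_lt_one hδ (by norm_num : (1 / 2 : ℝ) < 1)
    exact ⟨max (max N 2) j, (le_max_left _ _).trans (le_max_left _ _),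
      (le_max_right _ _).trans (le_max_left _ _),
      ((he _).trans_le (half_pow_le (le_max_right _ _))).trans hj⟩
  refine ⟨q 2, ?_, ?_, fun n hn => ?_⟩
  · refine le_of_forall_pos_le_add fun δ hδ => ?_
    obtain ⟨m, -, hm, hem⟩ := hlim δ hδ 0
    have := h0 m
    rw [hq m hm] at this
    linarith [(abs_lt.1 hem).2]
  · refine le_of_forall_pos_le_add fun δ hδ => ?_
    obtain ⟨m, -, hm, hem⟩ := hlim δ hδ 0
    have := h1 m
    rw [hq m hm] at this
    linarith [(abs_lt.1 hem).1]
  -- The strict inequality in `cone` is an open condition: it survives a small error, and `m ≥ f n`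
  -- makes the error in the second coordinate divisible by `2 ^ f n`.
  · obtain ⟨m, hfm, hm, hem⟩ := hlim _ (sub_pos.2 hn) (f n)
    have := hd m n (by rw [hq m hm]; linarith [(abs_lt.1 hem).2])
    exact (dvd_add_left ((pow_dvd_pow 2 hfm).trans (hv m))).1 this

/-- Test with `(a, 2 ^ f n)`, whose circle coordinate lies in `(2⁻⁽ⁿ⁺¹⁾, 2⁻ⁿ)`: only the conditions
`j ≤ n` are active, and the strongest is the one at `n`. -/
theorem le_of_cone_subset {n : ℕ} (hf : Monotone f) (hsub : cone f k ⊆ cone g 0)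
    (hn : k + 2 ≤ n) : g n ≤ f n := by
  obtain ⟨a, p, h0, h1⟩ := exists_mul_sqrt_two_sub_mem_Ioo
    (pow_lt_pow_right_of_lt_one₀ (by norm_num) (by norm_num) n.lt_succ_self :
      (1 / 2 : ℝ) ^ (n + 1) < (1 / 2) ^ n)
  have hmem : ((a, 2 ^ f n) : ℤ × ℤ) ∈ cone f k := by
    refine ⟨p, (pow_pos (by norm_num) _).le.trans h0.le, h1.le.trans (half_pow_le hn),
      fun j hj => pow_dvd_pow 2 (hf ?_)⟩
    by_contra! hnj
    exact absurd (h0.trans hj) (not_lt.2 (half_pow_le hnj))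
  obtain ⟨q, hq0, hq1, hq⟩ := hsub hmem
  have hpq : p = q := by
    refine int_eq_of_abs_sub_lt ?_
    have h2 : (1 / 2 : ℝ) ^ n ≤ 1 / 4 := (half_pow_le (by omega : 2 ≤ n)).trans (by norm_num)
    have h3 : (0 : ℝ) < (1 / 2) ^ (n + 1) := by positivity
    norm_num at hq1
    rw [abs_lt]
    constructor <;> linarith
  subst hpq
  have h4 : (2 : ℤ) ^ g n ∣ 2 ^ f n := hq n h1
  exact (Nat.pow_dvd_pow_iff_le_right (le_refl 2)).1 (by exact_mod_cast h4)

/-! ### Slopes from almost disjoint sets -/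

section Slopes

variable {K : Type} (e : K → ℕ → Bool)

open Classical in
/-- The exponents attached to a finite set of binary sequences. -/
noncomputable def steepness (s : Finset K) (n : ℕ) : ℕ :=
  n + if ∃ i ∈ s, n ∈ prefixCodes (e i) then 1 else 0

theorem le_steepness (s : Finset K) (n : ℕ) : n ≤ steepness e s n := Nat.le_add_right _ _

theorem steepness_monotone (s : Finset K) : Monotone (steepness e s) :=
  monotone_nat_of_le_succ fun n => by unfold steepness; split_ifs <;> omega

theorem steepness_mono {s t : Finset K} (h : s ⊆ t) : steepness e s ≤ steepness e t := by
  intro n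
  unfold steepness
  split_ifs with h1 h2
  · rfl
  · obtain ⟨i, hi, hn⟩ := h1
    exact absurd ⟨i, h hi, hn⟩ h2
  · exact Nat.le_succ _
  · rfl

variable {e}

/-- If `i ∉ s`, almost disjointness leaves infinitely many codes of `e i` outside those of `s`;
there the inequality reads `n + 1 ≤ n`. -/
theorem mem_of_steepness_le (he : Function.Injective e) {s : Finset K} {i : K} {N : ℕ}
    (h : ∀ n ≥ N, steepness e {i} n ≤ steepness e s n) : i ∈ s := by
  by_contra hi
  have hfin : (Set.Iio N ∪ ⋃ j ∈ s, prefixCodes (e i) ∩ prefixCodes (e j)).Finite :=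
    (Set.finite_Iio N).union (s.finite_toSet.biUnion fun j hj =>
      prefixCodes_inter_finite fun hij => hi (he hij ▸ hj))
  obtain ⟨n, hn, hnot⟩ := (prefixCodes_infinite (e i)).exists_notMem_finite hfin
  have hnN : N ≤ n := by
    by_contra hlt
    exact hnot (Or.inl (not_le.1 hlt))
  have hns : ¬ ∃ j ∈ s, n ∈ prefixCodes (e j) := fun ⟨j, hj, hnj⟩ =>
    hnot (Or.inr (Set.mem_biUnion hj ⟨hn, hnj⟩))
  have := h n hnN
  simp [steepness, hns, hn] at this

open Multiplicative in
/-- The cones with slopes given by an injective family of binary sequences. -/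
noncomputable def coneSystem (he : Function.Injective e) :
    ConeSystem (Multiplicative (ℤ × ℤ)) K where
  V n := toAdd ⁻¹' denseBall n
  U s k := toAdd ⁻¹' cone (steepness e s) k
  V_anti := fun _ _ h => Set.preimage_mono (denseBall_anti h)
  V_mul n := by
    rintro _ ⟨x, hx, y, hy, rfl⟩
    exact denseBall_add hx hy
  V_inv _ _ hx := denseBall_neg hx
  V_sep _ hx := exists_notMem_denseBall hx
  V_cover n := by
    obtain ⟨F, hF, hcov⟩ := exists_finite_add_denseBall n
    refine ⟨ofAdd '' F, hF.image _, Set.eq_univ_of_forall fun x => ?_⟩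
    obtain ⟨y, hy, hxy⟩ := hcov (toAdd x)
    exact Set.mem_mul.2 ⟨ofAdd y, ⟨y, hy, rfl⟩, x / ofAdd y, hxy, by simp⟩
  one_mem_U _ _ := zero_mem_cone
  U_subset_V s _ := Set.preimage_mono (cone_subset_denseBall (le_steepness e s))
  U_mul s k := by
    rintro _ ⟨x, hx, y, hy, rfl⟩
    exact cone_add hx hy
  U_anti _ _ _ _ hst hkl := Set.preimage_mono (cone_anti (steepness_mono e hst) hkl)
  U_interior s k := by
    obtain ⟨w, m, hw⟩ := exists_add_denseBall_subset_cone (steepness e s) k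
    refine ⟨ofAdd w, m, ?_⟩
    rintro _ ⟨v, hv, rfl⟩
    exact hw _ hv
  U_closed s k x hx := by
    by_contra! h
    refine hx (mem_cone_of_forall_exists fun m => ?_)
    obtain ⟨_, ⟨v, hv, rfl⟩, hU⟩ := Set.not_disjoint_iff.1 (h m)
    exact ⟨toAdd v, hv, hU⟩
  U_indep s k i h := by
    refine mem_of_steepness_le he (N := k + 2) fun n hn =>
      le_of_cone_subset (k := k) (steepness_monotone e s) (fun x hx => ?_) hn
    exact h (show ofAdd x ∈ toAdd ⁻¹' cone (steepness e s) k from hx)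

end Slopes

/-! ### Conclusion -/

theorem dominatingNumber_le_continuum : dominatingNumber ≤ 𝔠 := by
  have h : dominatingNumber ≤ #(Set.univ : Set (ℕ → ℕ)) :=
    csInf_le' ⟨Set.univ, fun x => ⟨x, trivial, fun _ => le_rfl⟩, rfl⟩
  simpa using h

theorem corollary7 (κ : Cardinal.{0}) (hκ : ℵ₀ < κ) (hκd : κ ≤ dominatingNumber) :
    ∃ (G : Type) (_ : CommGroup G) (τ : TopologicalSpace G),
      ContinuousMul G ∧ T2Space G ∧ Countable G ∧
      IsFlatRegular τ ∧ IsTotallyBoundedGroup τ ∧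
      ℵ₀ = character (flatTopology τ) ∧
      character (flatTopology τ) = piWeight τ ∧
      piWeight τ < character τ ∧
      character τ = κ := by
  classical
  have hle : #κ.out ≤ #(ℕ → Bool) := by
    simpa using hκd.trans dominatingNumber_le_continuum
  obtain ⟨e⟩ := hle
  let S := coneSystem e.injective
  obtain ⟨τ, hmul, hτ⟩ := S.exists_paratopology
  replace hτ : S.Generates τ := hτ
  have : Countable (Multiplicative (ℤ × ℤ)) := inferInstanceAs (Countable (ℤ × ℤ))
  have hχ : character τ = κ := by
    rw [hτ.character_eq (by simpa using hκ), mk_out]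
  refine ⟨_, inferInstance, τ, hmul, hτ.t2Space, this, hτ.isFlatRegular,
    hτ.isTotallyBoundedGroup, hτ.character_flat.symm, ?_, ?_, hχ⟩
  · rw [hτ.character_flat, hτ.piWeight_eq]
  · rw [hτ.piWeight_eq, hχ]
    exact hκ
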